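/- Words are finite sequences of positive integers; the weight of a word is recorded by its length and by the sum of its letters. For words $u,w$, let $\mathrm{Em}(u,w)$ be the set of all $j\ge 1$ such that the factor $w_jw_{j+1}\cdots w_{j+|u|-1}$ of $w$ exists and $u_k\le w_{j+k-1}$ for all $1\le k\le |u|$. Two words $u,v$ are super-strongly Wilf equivalent, $u\sim_{ss}v$, if there is a bijection $f$ from the set of all words to itself that preserves length and sum of letters and satisfies $\mathrm{Em}(u,w)=\mathrm{Em}(v,f(w))$ for every word $w$. Write $[m]=\{1,\dots,m\}$ and let $\mathcal S_n$ be the set of permutations of $[n]$, written as words in one-line notation; $w^{-1}$ denotes the inverse permutation. For a word $u$, let $\mathrm{alph}(u)$ be the set of its letters, and for a word $v$ with distinct letters let $\mathrm{red}(v)$ be the word obtained by replacing its smallest letter by $1$, its second smallest by $2$, and so on. A finite set of at least two positive integers is called periodic if the differences of its consecutive elements, listed increasingly, are all equal. For $n\ge 4$ and $2\le i\le n-2$ let $\mathcal E_{i,n}$ be the set of words $u=u_1\cdots u_i$ that are prefixes of permutations in $\mathcal S_n$ such that $[n]\setminus\mathrm{alph}(u)$ is periodic, while $[n]\setminus\{u_1,\dots,u_j\}$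 is not periodic for every $1\le j<i$; let $\mathcal E_{1,n}=\{1\}$, the set consisting of the one-letter word $1$. Define $\mathcal R_1=\{1\}$, $\mathcal R_2=\{12\}$, $\mathcal R_3=\{123,213\}$ and, recursively for $n\ge 4$, $$\mathcal R_n=\{\,u\cdot v\in\mathcal S_n \;:\; u\in\mathcal E_{i,n},\ \mathrm{red}(v)\in\mathcal R_{n-i},\ i\in[n-2]\,\}.$$ Then for every $n\ge 1$ the set $\mathcal C_n=\{w^{-1} : w\in\mathcal R_n\}\subseteq\mathcal S_n$ is a complete set of representatives of the super-strong Wilf equivalence classes of $\mathcal S_n$: every $u\in\mathcal S_n$ is super-strongly Wilf equivalent to exactly one element of $\mathcal C_n$. -/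

import Mathlib

namespace SSWilf

/-- Words on the alphabet of positive integers. -/
abbrev Word : Type := List ℕ+

/-- The norm (height) of a word: the sum of its letters. -/
def norm (w : Word) : ℕ := (w.map (fun a => (a : ℕ))).sum

/-- The set of letters occurring in a word, as a finite set of natural numbers. -/
def alph (w : Word) : Finset ℕ := (w.map (fun a => (a : ℕ))).toFinset

/-- The embedding set of `u` in `w`: the 1-based starting positions `j` of those factors `v` of `w`
with the same length as `u` and `u` entrywise at most `v`. -/
def Em (u w : Word) : Set ℕ :=
  {j | ∃ s v t : Word, w = s ++ v ++ t ∧ j = s.length + 1 ∧ List.Forall₂ (· ≤ ·) u v}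

/-- Super-strong Wilf equivalence of words: there is a weight-preserving bijection of the set of
all words which carries embedding sets of `u` to embedding sets of `v`. -/
def Equivalent (u v : Word) : Prop :=
  ∃ f : Word ≃ Word,
    (∀ w, (f w).length = w.length ∧ norm (f w) = norm w) ∧ ∀ w, Em u w = Em v (f w)

theorem equivalent_equivalence : Equivalence Equivalent where
  refl _ := ⟨Equiv.refl _, fun _ => ⟨rfl, rfl⟩, fun _ => rfl⟩
  symm := by
    rintro u v ⟨f, hf, hE⟩
    refine ⟨f.symm, fun w => ?_, fun w => ?_⟩
    · have h := hf (f.symm w)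
      rw [Equiv.apply_symm_apply] at h
      exact ⟨h.1.symm, h.2.symm⟩
    · rw [hE (f.symm w), Equiv.apply_symm_apply]
  trans := by
    rintro u v x ⟨f, hf, hE⟩ ⟨g, hg, hG⟩
    refine ⟨f.trans g, fun w => ?_, fun w => ?_⟩
    · exact ⟨(hg (f w)).1.trans (hf w).1, (hg (f w)).2.trans (hf w).2⟩
    · exact (hE w).trans (hG (f w))

/-- The one-line notation of a permutation, with letters `1, …, n`. -/
def word {n : ℕ} (σ : Equiv.Perm (Fin n)) : Word := List.ofFn (fun k => (σ k : ℕ).succPNat)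

/-- The vector of consecutive differences of a finite set of integers, listed increasingly. -/
def differences (X : Finset ℕ) : List ℕ :=
  List.zipWith (fun a b => b - a) (X.sort (· ≤ ·)) (X.sort (· ≤ ·)).tail

/-- A set with at least two elements is periodic when all its consecutive differences equal some
positive `d`. -/
def Periodic (X : Finset ℕ) : Prop :=
  2 ≤ X.card ∧ ∃ d : ℕ, 0 < d ∧ differences X = List.replicate (X.card - 1) d

/-- The set `D_{i,n}` (used for `1 ≤ i ≤ n - 2`): prefixes `u` of length `i` of permutations in
`S_n` such that `[n] \ alph u` is periodic, while `[n] \ alph u'` is not periodic for the shorter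
non-empty prefixes `u'` of `u`. -/
def D (i n : ℕ) : Set Word :=
  {u | u.length = i ∧ (∃ σ : Equiv.Perm (Fin n), u <+: word σ) ∧
    Periodic (Finset.Icc 1 n \ alph u) ∧
    ∀ j, 1 ≤ j → j < i → ¬ Periodic (Finset.Icc 1 n \ alph (u.take j))}

/-- The set `E_{i,n}`: it is `{1}` for `i = 1`, and `D_{i,n}` for `i ≥ 2`. -/
def E (i n : ℕ) : Set Word := if i = 1 then {[1]} else D i n

/-- The reduced form of a word with distinct letters: the smallest letter is replaced by `1`, the
second smallest by `2`, and so on. -/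
def red (v : Word) : Word :=
  v.map (fun a => (v.toFinset.filter (fun b => b < a)).card.succPNat)

/-- The sets `R_n`. In one-line notation the initial values are `R_1 = {1}`, `R_2 = {12}` and
`R_3 = {123, 213}`; for `n ≥ 4` the set `R_n` is given by the recursion. (`R_0` is not used.) -/
def R : (n : ℕ) → Set (Equiv.Perm (Fin n))
  | 0 => ∅
  | 1 => {1}
  | 2 => {1}
  | 3 => {1, Equiv.swap 0 1}
  | n + 4 => {w | ∃ i : ℕ, ∃ _ : 1 ≤ i ∧ i ≤ (n + 4) - 2, ∃ u v : Word,
      word w = u ++ v ∧ u ∈ E i (n + 4) ∧ ∃ τ ∈ R (n + 4 - i), red v = word τ}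
termination_by n => n
decreasing_by omega

/-- The set `C_n` of inverses of the elements of `R_n`. -/
def C (n : ℕ) : Set (Equiv.Perm (Fin n)) := {c | ∃ w ∈ R n, c = w⁻¹}

end SSWilf

/-! Count letters from 0, and let level `i` of σ be the set of positions where σ is at least `i`.
Equivalence of two permutations means exactly that their levels agree up to translation, one `i` at
a time (`equivalent_word_iff`). Forcing σ to embed at all positions of `S` costs a least total
excess `∑ |S + level σ (i + 1)|`. Equivalence makes these costs agree for every `S`, and
inclusion–exclusion then recovers each level up to translation (`translate_of_sum_card_add_eq`).
Conversely, when costs agree, exchanging one demand for the other matches the words that embed at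
least at `S`; Möbius inversion over `S` matches those that embed exactly at `S`. The levels of σ
are, up to a shift by 1, the letter sets of the suffixes of the inverse word. So each class consists
of inverse words whose suffix sets agree up to translation. Reading from the left, the only freedom
is to remove the minimum instead of the maximum from an arithmetic progression
(`isAP_of_erase_eq_image_erase`). Forbidding the maximum there (`Canonical`) picks exactly one word
per class. The recursion for `R` cuts a word at its first proper periodic suffix; since `red` is
affine on a progression, it describes precisely the canonical words (`mem_R_iff_canonical`). -/

namespace SSWilf
open Finset
open scoped Pointwise

/-! ### Recovering sets up to translation from sumset cardinalities -/

/-- Two finite sets of integers are translates of each other. -/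
def Translate (X Y : Finset ℤ) : Prop := ∃ t : ℤ, Y = X.image (· + t)

theorem Translate.refl (X : Finset ℤ) : Translate X X := ⟨0, by simp⟩

theorem Translate.symm {X Y : Finset ℤ} (h : Translate X Y) : Translate Y X := by
  obtain ⟨t, rfl⟩ := h
  exact ⟨-t, by rw [image_image]; simp only [Function.comp_def, add_neg_cancel_right, image_id']⟩

theorem Translate.trans {X Y Z : Finset ℤ} (h : Translate X Y) (h' : Translate Y Z) :
    Translate X Z := by
  obtain ⟨t, rfl⟩ := h
  obtain ⟨s, rfl⟩ := h'
  exact ⟨t + s, by rw [image_image]; simp only [Function.comp_def, add_assoc]⟩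

theorem Translate.card_eq {X Y : Finset ℤ} (h : Translate X Y) : #Y = #X := by
  obtain ⟨t, rfl⟩ := h
  exact card_image_of_injective _ (add_left_injective t)

/-- The set of all `p` belonging to every translate `s + X` with `s ∈ S`. -/
def commonTranslates (S X : Finset ℤ) : Finset ℤ :=
  if h : S.Nonempty then S.inf' h (fun s => X.image (s + ·)) else ∅

theorem mem_commonTranslates {S X : Finset ℤ} (h : S.Nonempty) (p : ℤ) :
    p ∈ commonTranslates S X ↔ ∀ s ∈ S, p - s ∈ X := by
  rw [commonTranslates, dif_pos h, mem_inf']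
  refine forall₂_congr fun s _ => ?_
  rw [mem_image]
  exact ⟨fun ⟨a, ha, e⟩ => by rwa [← e, add_sub_cancel_left], fun h => ⟨_, h, by ring⟩⟩

/-- Inclusion–exclusion for `S + X` as the union of the translates `s + X`; the intersections are
the sets `commonTranslates T X`. -/
theorem card_add_eq_sum (S X : Finset ℤ) :
    (#(S + X) : ℤ) = ∑ T ∈ S.powerset with T.Nonempty,
      (-1 : ℤ) ^ (#T + 1) * #(commonTranslates T X) := by
  have h : S + X = S.biUnion (fun s => X.image (s + ·)) := by
    ext p; simp only [mem_add, mem_biUnion, mem_image]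
  rw [h, inclusion_exclusion_card_biUnion, ← sum_coe_sort _ (fun T =>
    (-1 : ℤ) ^ (#T + 1) * #(commonTranslates T X))]
  refine sum_congr rfl fun T _ => ?_
  rw [commonTranslates, dif_pos (mem_filter.1 T.2).2]

/-- In the inclusion–exclusion formula for `T`, the term of `T` itself has coefficient ±1 and all
others come from proper subsets, so induction on `T` isolates it. -/
theorem sum_card_commonTranslates_eq {n : ℕ} {X Y : ℕ → Finset ℤ}
    (h : ∀ S : Finset ℤ, ∑ i ∈ range n, #(S + X i) = ∑ i ∈ range n, #(S + Y i))
    (T : Finset ℤ) :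
    ∑ i ∈ range n, #(commonTranslates T (X i)) = ∑ i ∈ range n, #(commonTranslates T (Y i)) := by
  induction T using Finset.strongInduction with
  | H T ih =>
    by_cases hT : T.Nonempty
    swap
    · simp [commonTranslates, hT]
    have key : ∀ Z : ℕ → Finset ℤ, ((∑ i ∈ range n, #(T + Z i) : ℕ) : ℤ) =
        (-1 : ℤ) ^ (#T + 1) * (∑ i ∈ range n, #(commonTranslates T (Z i)) : ℕ) +
        ∑ S ∈ ({S ∈ T.powerset | S.Nonempty}.erase T),
          (-1 : ℤ) ^ (#S + 1) * (∑ i ∈ range n, #(commonTranslates S (Z i)) : ℕ) := by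
      intro Z
      rw [add_sum_erase _ (fun S => (-1 : ℤ) ^ (#S + 1) *
        ((∑ i ∈ range n, #(commonTranslates S (Z i)) : ℕ) : ℤ)) (by simpa using hT)]
      push_cast
      simp_rw [card_add_eq_sum, mul_sum]
      exact sum_comm
    have hX := key X
    have hY := key Y
    rw [h T, hY] at hX
    have hs : ∑ S ∈ ({S ∈ T.powerset | S.Nonempty}.erase T),
          (-1 : ℤ) ^ (#S + 1) * (∑ i ∈ range n, #(commonTranslates S (X i)) : ℕ) =
        ∑ S ∈ ({S ∈ T.powerset | S.Nonempty}.erase T),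
          (-1 : ℤ) ^ (#S + 1) * (∑ i ∈ range n, #(commonTranslates S (Y i)) : ℕ) := by
      refine sum_congr rfl fun S hS => ?_
      simp only [mem_erase, mem_filter, mem_powerset] at hS
      rw [ih S (Finset.ssubset_iff_subset_ne.2 ⟨hS.2.1, hS.1⟩)]
    rw [hs] at hX
    have := mul_left_cancel₀ (pow_ne_zero _ (by norm_num)) (add_right_cancel hX)
    exact_mod_cast this.symm

theorem Translate.card_commonTranslates {X Y : Finset ℤ} (h : Translate X Y) (T : Finset ℤ) :
    #(commonTranslates T Y) = #(commonTranslates T X) := by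
  by_cases hT : T.Nonempty
  swap
  · simp [commonTranslates, hT]
  obtain ⟨t, rfl⟩ := h
  refine Translate.card_eq ⟨t, ?_⟩
  ext p
  simp only [mem_commonTranslates hT, mem_image]
  constructor
  · intro H
    refine ⟨p - t, fun s hs => ?_, by ring⟩
    obtain ⟨a, ha, e⟩ := H s hs
    convert ha using 1
    linarith
  · rintro ⟨q, hq, rfl⟩ s hs
    exact ⟨q - s, hq s hs, by ring⟩

/-- For `T = -X i`, `commonTranslates T Z` is the set of `p` with `X i + p ⊆ Z`. Earlier indices
cancel by induction, later sets are too small to contribute, so `Y i` contains a translate of `X i`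
and equals it by cardinality. -/
theorem translate_of_sum_card_add_eq {n : ℕ} {X Y : ℕ → Finset ℤ}
    (hX : ∀ i < n, #(X i) = n - i) (hY : ∀ i < n, #(Y i) = n - i)
    (h : ∀ S : Finset ℤ, ∑ i ∈ range n, #(S + X i) = ∑ i ∈ range n, #(S + Y i)) :
    ∀ i < n, Translate (X i) (Y i) := by
  intro i
  induction i using Nat.strong_induction_on with
  | _ i ih =>
    intro hi
    set T : Finset ℤ := (X i).image (fun x => -x) with hTdef
    have hne : T.Nonempty := by
      rw [hTdef, image_nonempty, ← card_pos, hX i hi]; omega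
    have hcT : ∀ Z : Finset ℤ, ∀ p, p ∈ commonTranslates T Z ↔ (X i).image (· + p) ⊆ Z := by
      intro Z p
      rw [mem_commonTranslates hne]
      simp only [hTdef, mem_image, forall_exists_index, and_imp, forall_apply_eq_imp_iff₂,
        image_subset_iff, sub_neg_eq_add, add_comm p]
    have hci : ∀ p, #((X i).image (· + p)) = n - i := fun p => by
      rw [card_image_of_injective _ (add_left_injective p), hX i hi]
    have hzero : ∀ Z : Finset ℤ, #Z < n - i → #(commonTranslates T Z) = 0 := by
      intro Z hZ
      rw [card_eq_zero, eq_empty_iff_forall_notMem]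
      intro p hp
      have := card_le_card ((hcT Z p).1 hp)
      rw [hci] at this
      omega
    have hsum := sum_card_commonTranslates_eq h T
    have hoff : ∑ l ∈ (range n).erase i, #(commonTranslates T (X l)) =
        ∑ l ∈ (range n).erase i, #(commonTranslates T (Y l)) := by
      refine sum_congr rfl fun l hl => ?_
      simp only [mem_erase, mem_range] at hl
      rcases lt_or_gt_of_ne hl.1 with h1 | h1
      · exact ((ih l h1 hl.2).card_commonTranslates T).symm
      · rw [hzero _ (by rw [hX l hl.2]; omega), hzero _ (by rw [hY l hl.2]; omega)]
    rw [← add_sum_erase _ _ (mem_range.2 hi), ← add_sum_erase _ _ (mem_range.2 hi), hoff] at hsum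
    have heq := add_right_cancel hsum
    have h0 : (0 : ℤ) ∈ commonTranslates T (X i) := by rw [hcT]; simp
    have hpos : 0 < #(commonTranslates T (Y i)) := heq ▸ card_pos.2 ⟨0, h0⟩
    obtain ⟨p, hp⟩ := card_pos.1 hpos
    refine ⟨p, (eq_of_subset_of_card_le ((hcT _ p).1 hp) ?_).symm⟩
    rw [hci, hY i hi]

end SSWilf

/-! ### Embeddings as lower bounds on excess, and their cost -/

namespace SSWilf
open Finset
open scoped Pointwise

/-- The letters of `w` diminished by one, padded by zeros. -/
def excess (w : Word) (p : ℕ) : ℕ := (w.getD p 1).natPred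

theorem excess_ofFn {N : ℕ} (f : Fin N → ℕ) (p : ℕ) (hp : p < N) :
    excess (List.ofFn (fun k => (f k).succPNat)) p = f ⟨p, hp⟩ := by
  simp [excess, List.getD, hp]

theorem eq_ofFn_excess (w : Word) :
    List.ofFn (fun k : Fin w.length => (excess w k).succPNat) = w := by
  apply List.ext_getElem (by simp)
  intro p h1 h2
  simp [excess, List.getD]

theorem norm_eq (w : Word) : norm w = (w.map PNat.val).sum := by
  simp [norm, List.map_eq_flatMap]

theorem alph_eq (w : Word) : alph w = (w.map PNat.val).toFinset := by
  simp [alph, List.map_eq_flatMap]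

theorem norm_eq_sum_excess (w : Word) :
    norm w = w.length + ∑ p ∈ range w.length, excess w p := by
  conv_lhs => rw [← eq_ofFn_excess w]
  rw [norm_eq, List.map_ofFn, List.sum_ofFn, ← Fin.sum_univ_eq_sum_range]
  simp [sum_add_distrib, add_comm]

variable {n : ℕ}

theorem succ_mem_Em_word (σ : Equiv.Perm (Fin n)) (w : Word) (s : ℕ) :
    s + 1 ∈ Em (word σ) w ↔ s + n ≤ w.length ∧ ∀ k : Fin n, (σ k : ℕ) ≤ excess w (s + k) := by
  constructor
  · rintro ⟨a, v, t, rfl, hs, h⟩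
    obtain rfl : s = a.length := by omega
    have hl : v.length = n := by simpa [word] using h.length_eq.symm
    refine ⟨by simp [hl], fun k => ?_⟩
    have hk : (k : ℕ) < v.length := hl ▸ k.2
    have := (List.forall₂_iff_get.1 h).2 k (by simp [word]) hk
    have e : excess (a ++ v ++ t) (a.length + k) = v[(k : ℕ)].natPred := by
      simp only [excess, List.getD, List.append_assoc]
      rw [List.getElem?_append_right (by omega), Nat.add_sub_cancel_left,
        List.getElem?_append_left hk, List.getElem?_eq_getElem hk, Option.getD_some]
    rw [e]
    simp only [word, List.get_eq_getElem, List.getElem_ofFn] at this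
    rw [← PNat.coe_le_coe, Nat.succPNat_coe] at this
    have h2 := PNat.natPred_add_one v[(k : ℕ)]
    simp only [Fin.eta] at this
    omega
  · rintro ⟨hl, h⟩
    refine ⟨w.take s, (w.drop s).take n, (w.drop s).drop n, ?_, ?_, ?_⟩
    · simp
    · simp; omega
    · rw [List.forall₂_iff_get]
      refine ⟨by simp [word, Nat.le_sub_iff_add_le' (show s ≤ w.length by omega), hl], fun k hk hk' => ?_⟩
      have hkn : k < n := by simpa [word] using hk
      have hkw : s + k < w.length := by omega
      have := h ⟨k, hkn⟩
      simp only [excess, List.getD, List.getElem?_eq_getElem hkw, Option.getD_some] at this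
      simp only [word, List.get_eq_getElem, List.getElem_ofFn, List.getElem_take,
        List.getElem_drop]
      rw [← PNat.coe_le_coe, Nat.succPNat_coe]
      have h2 := PNat.natPred_add_one w[s + k]
      omega

theorem exists_succ_of_mem_Em {u w : Word} {j : ℕ} (h : j ∈ Em u w) :
    ∃ s ≤ w.length, j = s + 1 := by
  obtain ⟨a, v, t, rfl, rfl, -⟩ := h
  exact ⟨a.length, by simp, rfl⟩

/-- The least excess that a word must have at position `p` if `σ` is to embed at all positions
of `S`. -/
def demand (σ : Equiv.Perm (Fin n)) (S : Finset ℕ) (p : ℕ) : ℕ :=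
  {x ∈ S ×ˢ (univ : Finset (Fin n)) | x.1 + x.2 = p}.sup (fun x => (σ x.2 : ℕ))

theorem demand_le_iff (σ : Equiv.Perm (Fin n)) (S : Finset ℕ) (f : ℕ → ℕ) :
    (∀ p, demand σ S p ≤ f p) ↔ ∀ s ∈ S, ∀ k : Fin n, (σ k : ℕ) ≤ f (s + k) := by
  simp only [demand, Finset.sup_le_iff, mem_filter, mem_product, mem_univ, and_true, Prod.forall,
    and_imp]
  constructor
  · intro h s hs k
    exact h _ s k hs rfl
  · rintro h _ s k hs rfl
    exact h s hs k

theorem forall_mem_Em_word_iff (σ : Equiv.Perm (Fin n)) (S : Finset ℕ) (w : Word) :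
    (∀ s ∈ S, s + 1 ∈ Em (word σ) w) ↔
      (∀ s ∈ S, s + n ≤ w.length) ∧ ∀ p, demand σ S p ≤ excess w p := by
  rw [demand_le_iff]
  simp only [succ_mem_Em_word]
  exact ⟨fun h => ⟨fun s hs => (h s hs).1, fun s hs => (h s hs).2⟩,
    fun h s hs => ⟨h.1 s hs, h.2 s hs⟩⟩

/-- The positions at which `σ` (with values counted from `0`) is at least `i`. -/
def level (σ : Equiv.Perm (Fin n)) (i : ℕ) : Finset ℤ :=
  (univ.filter (fun k : Fin n => i ≤ (σ k : ℕ))).image (fun k : Fin n => ((k : ℕ) : ℤ))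

theorem level_zero (σ τ : Equiv.Perm (Fin n)) : level σ 0 = level τ 0 := by simp [level]

theorem card_level (σ : Equiv.Perm (Fin n)) {i : ℕ} : #(level σ i) = n - i := by
  rw [level, card_image_of_injective _ (fun a b h => by simpa [Fin.ext_iff] using h)]
  have : #({k : Fin n | i ≤ (σ k : ℕ)}) = #({k : Fin n | i ≤ (k : ℕ)}) :=
    card_bij (fun k _ => σ k) (by simp) (by simp) fun b hb => ⟨σ.symm b, by simpa using hb⟩
  rw [this, ← Nat.card_Ico, ← card_image_of_injective _ Fin.val_injective]
  congr 1
  ext a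
  simp only [mem_image, mem_filter, mem_univ, true_and, mem_Ico]
  exact ⟨fun ⟨b, hb, e⟩ => ⟨e ▸ hb, e ▸ b.2⟩, fun h => ⟨⟨a, h.2⟩, h.1, rfl⟩⟩

theorem demand_eq_zero {σ : Equiv.Perm (Fin n)} {S : Finset ℕ} {N p : ℕ}
    (hS : ∀ s ∈ S, s + n ≤ N) (hp : N ≤ p) : demand σ S p = 0 := by
  rw [demand, filter_eq_empty_iff.2, sup_empty, Nat.bot_eq_zero]
  intro x hx
  have := hS x.1 (mem_product.1 hx).1
  have := x.2.2
  omega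

theorem lt_demand_iff (σ : Equiv.Perm (Fin n)) (S : Finset ℕ) (p i : ℕ) :
    i < demand σ S p ↔ (p : ℤ) ∈ S.image ((↑) : ℕ → ℤ) + level σ (i + 1) := by
  simp only [demand, Finset.lt_sup_iff, mem_filter, mem_product, mem_univ, and_true, Prod.exists,
    mem_add, mem_image, level, true_and]
  constructor
  · rintro ⟨s, k, ⟨hs, e⟩, h⟩
    exact ⟨s, ⟨s, hs, rfl⟩, k, ⟨k, h, rfl⟩, by exact_mod_cast e⟩
  · rintro ⟨_, ⟨s, hs, rfl⟩, _, ⟨k, h, rfl⟩, e⟩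
    exact ⟨s, k, ⟨hs, by exact_mod_cast e⟩, h⟩

/-- Layer-cake summation: the positions where the demand exceeds `i` are exactly `S + level σ (i +
1)`. -/
theorem sum_demand (σ : Equiv.Perm (Fin n)) (S : Finset ℕ) {N : ℕ} (hS : ∀ s ∈ S, s + n ≤ N) :
    ∑ p ∈ range N, demand σ S p =
      ∑ i ∈ range (n - 1), #(S.image ((↑) : ℕ → ℤ) + level σ (i + 1)) := by
  have h1 : ∀ p, demand σ S p = ∑ i ∈ range (n - 1), if i < demand σ S p then 1 else 0 := by
    intro p
    have hle : demand σ S p ≤ n - 1 := Finset.sup_le fun x _ => by have := (σ x.2).2; omega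
    rw [← card_filter]
    conv_lhs => rw [← card_range (demand σ S p)]
    congr 1
    ext i
    simp only [mem_range, mem_filter]
    omega
  rw [sum_congr rfl fun p _ => h1 p, sum_comm]
  refine sum_congr rfl fun i _ => ?_
  rw [← card_filter, ← card_image_of_injective _ (Nat.cast_injective (R := ℤ))]
  congr 1
  ext q
  simp only [mem_image, mem_filter, mem_range]
  constructor
  · rintro ⟨p, ⟨-, h⟩, rfl⟩
    exact (lt_demand_iff σ S p i).1 h
  · intro h
    have h' := h
    simp only [mem_add, mem_image, level] at h'
    obtain ⟨_, ⟨s, -, rfl⟩, _, ⟨k, -, rfl⟩, rfl⟩ := h'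
    rw [← Nat.cast_add, ← lt_demand_iff] at h
    refine ⟨s + k, ⟨?_, h⟩, by simp⟩
    by_contra hc
    rw [demand_eq_zero hS (not_lt.1 hc)] at h
    omega

/-- Level 0 consists of all positions and carries no information about σ; adding it brings the sum
to the indices `i < n` used in `translate_of_sum_card_add_eq`. -/
theorem sum_card_add_level (σ : Equiv.Perm (Fin n)) (S : Finset ℤ) :
    ∑ i ∈ range n, #(S + level σ i) =
      (if 0 < n then #(S + level σ 0) else 0) + ∑ i ∈ range (n - 1), #(S + level σ (i + 1)) := by
  cases n with
  | zero => simp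
  | succ n => simp [sum_range_succ' _ n, add_comm]

end SSWilf

/-! ### Equivalence of permutations through translates of levels -/

namespace SSWilf
open Finset
open scoped Pointwise

variable {n : ℕ}

theorem forall_le_excess_ofFn {N : ℕ} {f g : ℕ → ℕ} (h : ∀ p < N, f p ≤ g p)
    (h0 : ∀ p, N ≤ p → f p = 0) (p : ℕ) :
    f p ≤ excess (List.ofFn (fun k : Fin N => (g k).succPNat)) p := by
  rcases lt_or_ge p N with hp | hp
  · rw [excess_ofFn _ p hp]; exact h p hp
  · rw [h0 p hp]; exact Nat.zero_le _

/-- The cheapest word in which σ embeds at `S` has excess equal to the demand of σ. Its image has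
the same length and norm and must meet the demand of τ. -/
theorem Equivalent.sum_demand_le {σ τ : Equiv.Perm (Fin n)}
    (h : Equivalent (word σ) (word τ)) {S : Finset ℕ} {N : ℕ} (hS : ∀ s ∈ S, s + n ≤ N) :
    ∑ p ∈ range N, demand τ S p ≤ ∑ p ∈ range N, demand σ S p := by
  obtain ⟨f, hf, hE⟩ := h
  set w : Word := List.ofFn (fun k : Fin N => (demand σ S k).succPNat) with hw
  have hl : w.length = N := by simp [w]
  have hmem : ∀ s ∈ S, s + 1 ∈ Em (word σ) w :=
    (forall_mem_Em_word_iff σ S w).2 ⟨by rwa [hl],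
      forall_le_excess_ofFn (fun _ _ => le_rfl) fun p hp => demand_eq_zero hS hp⟩
  rw [hE w] at hmem
  have h1 := ((forall_mem_Em_word_iff τ S _).1 hmem).2
  have h2 := norm_eq_sum_excess w
  have h3 := norm_eq_sum_excess (f w)
  rw [(hf w).1, (hf w).2, hl] at h3
  rw [hl] at h2
  calc ∑ p ∈ range N, demand τ S p ≤ ∑ p ∈ range N, excess (f w) p :=
        sum_le_sum fun p _ => h1 p
    _ = ∑ p ∈ range N, excess w p := by omega
    _ = ∑ p ∈ range N, demand σ S p :=
        sum_congr rfl fun p hp => excess_ofFn _ p (mem_range.1 hp)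

theorem Equivalent.translate_level {σ τ : Equiv.Perm (Fin n)}
    (h : Equivalent (word σ) (word τ)) : ∀ i < n, Translate (level σ i) (level τ i) := by
  refine translate_of_sum_card_add_eq (fun i _ => card_level σ) (fun i _ => card_level τ) ?_
  intro S
  rw [sum_card_add_level, sum_card_add_level, level_zero σ τ]
  congr 1
  -- Demands are indexed by natural positions, so `S` is first shifted to be nonnegative; sumset
  -- cardinalities do not notice.
  obtain ⟨c, hc⟩ : ∃ c : ℤ, ∀ s ∈ S, 0 ≤ c + s := by
    obtain ⟨b, hb⟩ := S.bddBelow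
    exact ⟨-b, fun s hs => by have := hb (mem_coe.2 hs); omega⟩
  set S' : Finset ℕ := S.image (fun s => (c + s).toNat)
  have hS' : S'.image ((↑) : ℕ → ℤ) = {c} + S := by
    rw [image_image, singleton_add]
    exact image_congr fun s hs => Int.toNat_of_nonneg (hc s hs)
  have hcard : ∀ X : Finset ℤ, #(S'.image ((↑) : ℕ → ℤ) + X) = #(S + X) := by
    intro X
    rw [hS', add_assoc, card_singleton_add]
  have hN : ∀ s ∈ S', s + n ≤ S'.sup id + n := fun s hs =>
    Nat.add_le_add_right (le_sup (f := id) hs) n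
  have := le_antisymm (((equivalent_equivalence.symm h).sum_demand_le) hN) (h.sum_demand_le hN)
  rw [sum_demand _ _ hN, sum_demand _ _ hN] at this
  simpa only [hcard] using this

theorem sum_demand_eq_of_translate {σ τ : Equiv.Perm (Fin n)}
    (h : ∀ i < n, Translate (level σ i) (level τ i)) {S : Finset ℕ} {N : ℕ}
    (hS : ∀ s ∈ S, s + n ≤ N) :
    ∑ p ∈ range N, demand σ S p = ∑ p ∈ range N, demand τ S p := by
  rw [sum_demand σ S hS, sum_demand τ S hS]
  refine sum_congr rfl fun i hi => ?_
  obtain ⟨t, ht⟩ := h (i + 1) (by rw [mem_range] at hi; omega)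
  have e : level τ (i + 1) = level σ (i + 1) + {t} := by
    rw [ht]
    ext p
    simp only [mem_image, mem_add, mem_singleton, exists_eq_left]
  rw [e, ← add_assoc, card_add_singleton]

/-- Two set-valued functions having the same number of arguments with value containing `S`, for
every `S`, take every value equally often. -/
theorem card_fiber_eq_of_card_superset_eq {α β : Type*} [DecidableEq β] {A : Finset α}
    {e e' : α → Finset β} {U : Finset β} (he : ∀ a ∈ A, e a ⊆ U) (he' : ∀ a ∈ A, e' a ⊆ U)
    (h : ∀ S, #({a ∈ A | S ⊆ e a}) = #({a ∈ A | S ⊆ e' a})) (S : Finset β) :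
    #({a ∈ A | e a = S}) = #({a ∈ A | e' a = S}) := by
  -- Möbius inversion as downward induction on `S` inside `U`: the count for supersets of `S` is the
  -- count for `S` plus the counts for strictly larger sets.
  suffices H : ∀ k : ℕ, ∀ S : Finset β, S ⊆ U → #U - #S = k →
      #({a ∈ A | e a = S}) = #({a ∈ A | e' a = S}) by
    by_cases hS : S ⊆ U
    · exact H _ S hS rfl
    · rw [filter_eq_empty_iff.2 fun a ha (hc : e a = S) => hS (hc ▸ he a ha),
        filter_eq_empty_iff.2 fun a ha (hc : e' a = S) => hS (hc ▸ he' a ha)]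
  intro k
  induction k using Nat.strong_induction_on with
  | _ k ih =>
    intro S hS hk
    have key : ∀ g : α → Finset β, (∀ a ∈ A, g a ⊆ U) → #({a ∈ A | S ⊆ g a}) =
        #({a ∈ A | g a = S}) + ∑ T ∈ {T ∈ U.powerset | S ⊂ T}, #({a ∈ A | g a = T}) := by
      intro g hg
      have hmaps : ∀ a ∈ ({a ∈ A | S ⊆ g a} : Finset α), g a ∈ ({T ∈ U.powerset | S ⊆ T}) := by
        intro a ha
        rw [mem_filter] at ha
        exact mem_filter.2 ⟨mem_powerset.2 (hg a ha.1), ha.2⟩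
      rw [card_eq_sum_card_fiberwise hmaps]
      have hins : ({T ∈ U.powerset | S ⊆ T}) = insert S ({T ∈ U.powerset | S ⊂ T}) := by
        ext T
        simp only [mem_filter, mem_powerset, mem_insert, Finset.ssubset_iff_subset_ne]
        constructor
        · rintro ⟨h1, h2⟩
          rcases eq_or_ne S T with rfl | hne
          · exact Or.inl rfl
          · exact Or.inr ⟨h1, h2, hne⟩
        · rintro (rfl | ⟨h1, h2, -⟩)
          · exact ⟨hS, Subset.rfl⟩
          · exact ⟨h1, h2⟩
      have hfib : ∀ T, S ⊆ T → #({a ∈ ({a ∈ A | S ⊆ g a} : Finset α) | g a = T}) =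
          #({a ∈ A | g a = T}) := by
        intro T hT
        rw [filter_filter]
        congr 1
        refine filter_congr fun a _ => ⟨fun h => h.2, fun h => ⟨h ▸ hT, h⟩⟩
      rw [hins, sum_insert (by simp), hfib S Subset.rfl]
      congr 1
      exact sum_congr rfl fun T hT => hfib T (mem_filter.1 hT).2.subset
    have h1 := key e he
    have h2 := key e' he'
    have hs : ∑ T ∈ {T ∈ U.powerset | S ⊂ T}, #({a ∈ A | e a = T}) =
        ∑ T ∈ {T ∈ U.powerset | S ⊂ T}, #({a ∈ A | e' a = T}) := by
      refine sum_congr rfl fun T hT => ?_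
      rw [mem_filter, mem_powerset] at hT
      have hlt := card_lt_card hT.2
      have hle := card_le_card hT.1
      exact ih _ (by omega) T hT.1 rfl
    rw [h S, h2, hs] at h1
    exact (Nat.add_right_cancel h1).symm

/-- Needed so that words can be counted: each letter is at most the norm. -/
theorem finite_length_norm (N m : ℕ) : {w : Word | w.length = N ∧ norm w = m}.Finite := by
  have : Finite {a : ℕ+ // a ≤ m.succPNat} := (Set.finite_Iic m.succPNat).to_subtype
  refine ((List.finite_length_eq {a : ℕ+ // a ≤ m.succPNat} N).image
    (List.map Subtype.val)).subset ?_
  rintro w ⟨hl, hn⟩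
  have hmem : ∀ a ∈ w, a ≤ m.succPNat := by
    intro a ha
    rw [norm_eq] at hn
    have h1 : (a : ℕ) ≤ m := hn ▸ List.single_le_sum (by simp) _ (List.mem_map_of_mem ha)
    rw [← PNat.coe_le_coe, Nat.succPNat_coe]
    omega
  lift w to List {a : ℕ+ // a ≤ m.succPNat} using hmem
  exact ⟨w, by simpa using hl, rfl⟩

open Classical in
/-- The starting positions, counted from `0`, of the embeddings of `u` in `w`. -/
noncomputable def starts (u w : Word) : Finset ℕ := {s ∈ range (w.length + 1) | s + 1 ∈ Em u w}

theorem mem_starts {u w : Word} {s : ℕ} : s ∈ starts u w ↔ s + 1 ∈ Em u w := by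
  simp only [starts, mem_filter, mem_range, and_iff_right_iff_imp]
  intro h
  obtain ⟨t, ht, e⟩ := exists_succ_of_mem_Em h
  omega

theorem Em_eq_of_starts_eq {u v w x : Word} (h : starts u w = starts v x) : Em u w = Em v x := by
  have key : ∀ {u v w x : Word}, starts u w = starts v x → Em u w ⊆ Em v x := by
    intro u v w x h j hj
    obtain ⟨s, -, rfl⟩ := exists_succ_of_mem_Em hj
    exact mem_starts.1 (h ▸ mem_starts.2 hj)
  exact (key h).antisymm (key h.symm)

theorem subset_starts_word_iff (σ : Equiv.Perm (Fin n)) (S : Finset ℕ) (w : Word) :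
    S ⊆ starts (word σ) w ↔
      (∀ s ∈ S, s + n ≤ w.length) ∧ ∀ p, demand σ S p ≤ excess w p := by
  rw [← forall_mem_Em_word_iff]
  exact forall₂_congr fun s _ => mem_starts

/-- Replace the part `d` of the excess of `w` by `d'`. -/
def exchange (d d' : ℕ → ℕ) (w : Word) : Word :=
  List.ofFn (fun k : Fin w.length => (excess w k - d k + d' k).succPNat)

theorem length_exchange (d d' : ℕ → ℕ) (w : Word) : (exchange d d' w).length = w.length := by
  simp [exchange]

theorem excess_exchange (d d' : ℕ → ℕ) (w : Word) {p : ℕ} (hp : p < w.length) :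
    excess (exchange d d' w) p = excess w p - d p + d' p := excess_ofFn _ p hp

theorem norm_exchange {d d' : ℕ → ℕ} {w : Word} (h : ∀ p, d p ≤ excess w p)
    (hd : ∑ p ∈ range w.length, d p = ∑ p ∈ range w.length, d' p) :
    norm (exchange d d' w) = norm w := by
  rw [norm_eq_sum_excess, norm_eq_sum_excess, length_exchange,
    sum_congr rfl fun p hp => excess_exchange d d' w (mem_range.1 hp), sum_add_distrib, ← hd,
    ← sum_add_distrib, sum_congr rfl fun p _ => Nat.sub_add_cancel (h p)]

theorem exchange_exchange {d d' : ℕ → ℕ} {w : Word} (h : ∀ p, d p ≤ excess w p) :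
    exchange d' d (exchange d d' w) = w := by
  apply List.ext_getElem (by simp [length_exchange])
  intro p h1 h2
  have e : excess (exchange d' d (exchange d d' w)) p = excess w p := by
    rw [excess_exchange _ _ _ (by rwa [length_exchange]), excess_exchange _ _ _ h2,
      Nat.add_sub_cancel, Nat.sub_add_cancel (h p)]
  simpa [excess, List.getD, h1, h2, PNat.natPred_inj] using e

/-- At fixed length and norm, `exchange` is a bijection between the words where σ embeds at least at
`S` and those where τ does. Superset counts therefore agree, hence so do exact counts. -/
theorem equivalent_of_translate_level {σ τ : Equiv.Perm (Fin n)}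
    (h : ∀ i < n, Translate (level σ i) (level τ i)) : Equivalent (word σ) (word τ) := by
  classical
  let A : ℕ → ℕ → Finset Word := fun N m => (finite_length_norm N m).toFinset
  have hA : ∀ N m w, w ∈ A N m ↔ w.length = N ∧ norm w = m := fun N m w => by simp [A]
  have hsup : ∀ N m S, #({w ∈ A N m | S ⊆ starts (word σ) w}) =
      #({w ∈ A N m | S ⊆ starts (word τ) w}) := by
    intro N m S
    by_cases hS : ∀ s ∈ S, s + n ≤ N
    swap
    · have hemp : ∀ ρ : Equiv.Perm (Fin n), ({w ∈ A N m | S ⊆ starts (word ρ) w}) = ∅ := by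
        intro ρ
        rw [filter_eq_empty_iff]
        intro w hw hc
        rw [subset_starts_word_iff, ((hA N m w).1 hw).1] at hc
        exact hS hc.1
      rw [hemp, hemp]
    have hsum := sum_demand_eq_of_translate h hS
    have hmaps : ∀ ρ π : Equiv.Perm (Fin n),
        ∑ p ∈ range N, demand ρ S p = ∑ p ∈ range N, demand π S p →
        ∀ w ∈ ({w ∈ A N m | S ⊆ starts (word ρ) w}), exchange (demand ρ S) (demand π S) w ∈
          ({w ∈ A N m | S ⊆ starts (word π) w}) := by
      intro ρ π hρπ w hw
      rw [mem_filter, hA, subset_starts_word_iff] at hw ⊢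
      obtain ⟨⟨hl, hn⟩, -, hd⟩ := hw
      refine ⟨⟨by rw [length_exchange, hl], ?_⟩, by rwa [length_exchange, hl], ?_⟩
      · rw [norm_exchange hd (by rwa [hl]), hn]
      · intro p
        rcases lt_or_ge p N with hp | hp
        · rw [excess_exchange _ _ _ (by rwa [hl])]
          omega
        · rw [demand_eq_zero hS hp]
          exact Nat.zero_le _
    have hinv : ∀ ρ π : Equiv.Perm (Fin n), ∀ w ∈ ({w ∈ A N m | S ⊆ starts (word ρ) w}),
        exchange (demand π S) (demand ρ S) (exchange (demand ρ S) (demand π S) w) = w := by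
      intro ρ π w hw
      rw [mem_filter, subset_starts_word_iff] at hw
      exact exchange_exchange hw.2.2
    exact card_nbij' _ _ (hmaps σ τ hsum) (hmaps τ σ hsum.symm) (hinv σ τ) (hinv τ σ)
  have hsub : ∀ (ρ : Equiv.Perm (Fin n)) N m, ∀ w ∈ A N m,
      starts (word ρ) w ⊆ range (N + 1) := by
    intro ρ N m w hw
    rw [← ((hA N m w).1 hw).1]
    exact filter_subset _ _
  -- `F` records all that the bijection must preserve; it is glued from bijections between
  -- equinumerous fibres.
  let F : Equiv.Perm (Fin n) → Word → (ℕ × ℕ) × Finset ℕ :=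
    fun ρ w => ((w.length, norm w), starts (word ρ) w)
  have hfib : ∀ y, Nonempty ({w // F σ w = y} ≃ {w // F τ w = y}) := by
    rintro ⟨⟨N, m⟩, S⟩
    have hρ : ∀ ρ : Equiv.Perm (Fin n), ∀ w,
        F ρ w = ((N, m), S) ↔ w ∈ ({w ∈ A N m | starts (word ρ) w = S}) := by
      intro ρ w
      simp [F, hA]
    have hc := card_fiber_eq_of_card_superset_eq (hsub σ N m) (hsub τ N m) (hsup N m) S
    exact ⟨(Equiv.subtypeEquivRight (hρ σ)).trans
      ((Finset.equivOfCardEq hc).trans (Equiv.subtypeEquivRight (hρ τ)).symm)⟩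
  let e := fun y => (hfib y).some
  let f : Word ≃ Word := (Equiv.sigmaFiberEquiv (F σ)).symm.trans
    ((Equiv.sigmaCongrRight e).trans (Equiv.sigmaFiberEquiv (F τ)))
  have hf : ∀ w, F τ (f w) = F σ w := fun w => (e (F σ w) ⟨w, rfl⟩).2
  refine ⟨f, fun w => ?_, fun w => ?_⟩
  · have := congrArg Prod.fst (hf w)
    exact ⟨congrArg Prod.fst this, congrArg Prod.snd this⟩
  · exact Em_eq_of_starts_eq (congrArg Prod.snd (hf w)).symm

theorem equivalent_word_iff (σ τ : Equiv.Perm (Fin n)) :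
    Equivalent (word σ) (word τ) ↔ ∀ i < n, Translate (level σ i) (level τ i) :=
  ⟨Equivalent.translate_level, equivalent_of_translate_level⟩

end SSWilf

/-! ### Arithmetic progressions and the ambiguity of removing one element -/

namespace SSWilf
open Finset

/-- A set of at least two integers forming an arithmetic progression. -/
def IsAP (X : Finset ℤ) : Prop :=
  ∃ (m d : ℤ) (c : ℕ), 2 ≤ c ∧ 0 < d ∧ X = (range c).image (fun k : ℕ => m + k * d)

theorem injective_progression (m : ℤ) {d : ℤ} (hd : 0 < d) :
    Function.Injective (fun k : ℕ => m + k * d) := by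
  intro a b h
  have := mul_right_cancel₀ hd.ne' (add_left_cancel h)
  exact_mod_cast this

theorem IsAP.two_le_card {X : Finset ℤ} (h : IsAP X) : 2 ≤ #X := by
  obtain ⟨m, d, c, hc, hd, rfl⟩ := h
  rwa [card_image_of_injective _ (injective_progression m hd), card_range]

theorem isAP_pair {a b : ℤ} (h : a < b) : IsAP {a, b} := by
  refine ⟨a, b - a, 2, le_rfl, by omega, ?_⟩
  ext x
  simp [Finset.range_add_one, or_comm]

theorem isAP_Icc {a b : ℤ} (h : a < b) : IsAP (Icc a b) := by
  refine ⟨a, 1, (b - a + 1).toNat, by omega, one_pos, ?_⟩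
  ext x
  simp only [mem_Icc, mem_image, mem_range]
  constructor
  · intro hx
    exact ⟨(x - a).toNat, by omega, by omega⟩
  · rintro ⟨k, hk, rfl⟩
    omega

theorem isAP_image_iff (p : ℤ) {d : ℤ} (hd : 0 < d) (X : Finset ℤ) :
    IsAP (X.image (fun x => p + x * d)) ↔ IsAP X := by
  have hinj : Function.Injective (fun x : ℤ => p + x * d) := fun a b h =>
    mul_right_cancel₀ hd.ne' (add_left_cancel h)
  constructor
  · rintro ⟨m, e, c, hc, he, h⟩
    have h0 : m + (0 : ℕ) * e ∈ X.image (fun x => p + x * d) := by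
      rw [h]; exact mem_image_of_mem (fun k : ℕ => m + k * e) (mem_range.2 (by omega))
    have h1 : m + (1 : ℕ) * e ∈ X.image (fun x => p + x * d) := by
      rw [h]; exact mem_image_of_mem (fun k : ℕ => m + k * e) (mem_range.2 (by omega))
    obtain ⟨x, -, hx⟩ := mem_image.1 h0
    obtain ⟨y, -, hy⟩ := mem_image.1 h1
    push_cast at hx hy
    have hxy : e = (y - x) * d := by linarith
    refine ⟨x, y - x, c, hc, pos_of_mul_pos_left (hxy ▸ he) hd.le, image_injective hinj ?_⟩
    rw [h, image_image]
    refine image_congr fun k _ => ?_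
    simp only [Function.comp_apply, hxy]
    linear_combination -hx
  · rintro ⟨m, e, c, hc, he, rfl⟩
    refine ⟨p + m * d, e * d, c, hc, mul_pos he hd, ?_⟩
    rw [image_image]
    refine image_congr fun k _ => ?_
    simp only [Function.comp_apply]
    ring

/-- The only ambiguity in removing an element from a set known up to translation: the removed
element is the maximum of a progression. -/
theorem isAP_of_erase_eq_image_erase {X : Finset ℤ} {a b t : ℤ} (ha : a ∈ X) (hb : b ∈ X)
    (hX : 2 ≤ #X) (ht : 0 < t) (h : X.erase b = (X.erase a).image (· + t)) :
    IsAP X ∧ ∀ x ∈ X, x ≤ a := by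
  have up : ∀ x ∈ X, x ≠ a → x + t ∈ X := fun x hx hxa =>
    mem_of_mem_erase (h ▸ mem_image_of_mem (· + t) (mem_erase.2 ⟨hxa, hx⟩))
  have down : ∀ x ∈ X, x ≠ b → x - t ∈ X := by
    intro x hx hxb
    have : x ∈ (X.erase a).image (· + t) := h ▸ mem_erase.2 ⟨hxb, hx⟩
    obtain ⟨y, hy, rfl⟩ := mem_image.1 this
    rw [add_sub_cancel_right]
    exact mem_of_mem_erase hy
  -- If the maximum were not `a`, adding `t` would stay in `X`; dually the minimum is `b`.
  have hmax : ∀ x ∈ X, x ≤ a := by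
    have hM := X.max'_mem ⟨a, ha⟩
    by_cases hMa : X.max' ⟨a, ha⟩ = a
    · intro x hx
      rw [← hMa]
      exact X.le_max' x hx
    · have := X.le_max' _ (up _ hM hMa)
      omega
  have hmin : ∀ x ∈ X, b ≤ x := by
    have hM := X.min'_mem ⟨a, ha⟩
    by_cases hMb : X.min' ⟨a, ha⟩ = b
    · intro x hx
      rw [← hMb]
      exact X.min'_le x hx
    · have := X.min'_le _ (down _ hM hMb)
      omega
  -- Descending by steps of `t` can only stop at `b`, so `X` lies in the progression from `b`;
  -- climbing from `b` to `a` then fills it.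
  have hform : ∀ k : ℕ, ∀ x ∈ X, (x - b).toNat = k → ∃ j : ℕ, x = b + j * t := by
    intro k
    induction k using Nat.strong_induction_on with
    | _ k ih =>
      intro x hx hk
      by_cases hxb : x = b
      · exact ⟨0, by simp [hxb]⟩
      · have h1 := down x hx hxb
        have h2 := hmin _ h1
        obtain ⟨j, hj⟩ := ih _ (by omega) (x - t) h1 rfl
        exact ⟨j + 1, by push_cast; linarith⟩
  obtain ⟨K, hK⟩ := hform _ a ha rfl
  have hmem : ∀ k : ℕ, k ≤ K → b + k * t ∈ X := by
    intro k
    induction k with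
    | zero => simpa using hb
    | succ k ih =>
      intro hk
      have := up _ (ih (by omega)) (fun e => by
        have := injective_progression b ht (e.trans hK)
        omega)
      convert this using 1
      push_cast
      ring
  have hXeq : X = (range (K + 1)).image (fun k : ℕ => b + k * t) := by
    ext x
    simp only [mem_image, mem_range]
    constructor
    · intro hx
      obtain ⟨j, rfl⟩ := hform _ x hx rfl
      refine ⟨j, ?_, rfl⟩
      have := hmax _ hx
      rw [hK] at this
      have := le_of_mul_le_mul_right (le_of_add_le_add_left this) ht
      omega
    · rintro ⟨k, hk, rfl⟩
      exact hmem k (by omega)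
  refine ⟨⟨b, t, K + 1, ?_, ht, hXeq⟩, hmax⟩
  rwa [hXeq, card_image_of_injective _ (injective_progression b ht), card_range] at hX

/-- Makes it harmless to replace a forbidden maximum by the minimum: the remaining sets differ by
the shift `d`. -/
theorem translate_erase_max_erase_min {m d : ℤ} {c : ℕ} (hc : 2 ≤ c) (hd : 0 < d) {a : ℤ}
    (ha : a ∈ (range c).image (fun k : ℕ => m + k * d))
    (hmax : ∀ x ∈ (range c).image (fun k : ℕ => m + k * d), x ≤ a) :
    Translate (((range c).image (fun k : ℕ => m + k * d)).erase a)
      (((range c).image (fun k : ℕ => m + k * d)).erase m) := by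
  have hinj := injective_progression m hd
  have ha' : a = m + ((c - 1 : ℕ) : ℤ) * d := by
    refine le_antisymm ?_ (hmax _ (mem_image_of_mem _ (mem_range.2 (by omega))))
    obtain ⟨k, hk, rfl⟩ := mem_image.1 ha
    rw [mem_range] at hk
    have : (k : ℤ) ≤ ((c - 1 : ℕ) : ℤ) := by omega
    simpa using mul_le_mul_of_nonneg_right this hd.le
  refine ⟨d, ?_⟩
  ext x
  simp only [mem_erase, mem_image, mem_range]
  constructor
  · rintro ⟨hx, k, hk, rfl⟩
    obtain ⟨k, rfl⟩ : ∃ j, k = j + 1 := ⟨k - 1, by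
      have : k ≠ 0 := by rintro rfl; simp at hx
      omega⟩
    refine ⟨m + k * d, ⟨?_, k, by omega, rfl⟩, by push_cast; ring⟩
    rw [ha']
    intro e
    have := hinj e
    omega
  · rintro ⟨_, ⟨hx, k, hk, rfl⟩, rfl⟩
    refine ⟨?_, k + 1, ?_, by push_cast; ring⟩
    · have : 0 ≤ (k : ℤ) * d := by positivity
      omega
    · rw [ha'] at hx
      have : k ≠ c - 1 := by rintro rfl; exact hx rfl
      omega

/-! ### Canonical words: uniqueness and existence -/

/-- Corresponding suffixes of the two words have the same set of letters up to translation. -/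
def SuffixTranslate : List ℤ → List ℤ → Prop
  | [], [] => True
  | a :: l, b :: l' => Translate (a :: l).toFinset (b :: l').toFinset ∧ SuffixTranslate l l'
  | [], _ :: _ => False
  | _ :: _, [] => False

theorem suffixTranslate_iff (l l' : List ℤ) : SuffixTranslate l l' ↔
    l.length = l'.length ∧
      ∀ i < l.length, Translate (l.drop i).toFinset (l'.drop i).toFinset := by
  induction l generalizing l' with
  | nil => cases l' <;> simp [SuffixTranslate]
  | cons a l ih =>
    cases l' with
    | nil => simp [SuffixTranslate]
    | cons b l' =>
      rw [SuffixTranslate, ih]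
      constructor
      · rintro ⟨h, hl, H⟩
        refine ⟨by simp [hl], fun i hi => ?_⟩
        cases i with
        | zero => exact h
        | succ i => exact H i (by simpa using hi)
      · rintro ⟨hl, H⟩
        exact ⟨H 0 (by simp), by simpa using hl, fun i hi => H (i + 1) (by simpa using hi)⟩

/-- Whenever the letters of a suffix form a progression, the first letter of the suffix is not the
largest one. -/
def Canonical : List ℤ → Prop
  | [] => True
  | a :: l => (IsAP (a :: l).toFinset → ∃ b ∈ l, a < b) ∧ Canonical l

theorem canonical_iff (l : List ℤ) : Canonical l ↔ ∀ (i : ℕ) (hi : i < l.length),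
    IsAP (l.drop i).toFinset → ∃ b ∈ l.drop (i + 1), l[i] < b := by
  induction l with
  | nil => simp [Canonical]
  | cons a l ih =>
    rw [Canonical, ih]
    constructor
    · rintro ⟨h, H⟩ i hi
      cases i with
      | zero => simpa using h
      | succ i => exact H i (by simpa using hi)
    · intro H
      exact ⟨H 0 (by simp), fun i hi => H (i + 1) (by simpa using hi)⟩

theorem canonical_map_iff (p : ℤ) {d : ℤ} (hd : 0 < d) (l : List ℤ) :
    Canonical (l.map (fun x => p + x * d)) ↔ Canonical l := by
  induction l with
  | nil => rfl
  | cons a l ih =>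
    have hs : ((a :: l).map (fun x => p + x * d)).toFinset =
        (a :: l).toFinset.image (fun x => p + x * d) := by
      ext x; simp
    rw [List.map_cons] at hs ⊢
    rw [Canonical, Canonical, ih, hs, isAP_image_iff p hd]
    simp [hd]

theorem eq_of_suffixTranslate_of_canonical {l l' : List ℤ} (hl : l.Nodup) (hl' : l'.Nodup)
    (hs : l.toFinset = l'.toFinset) (h : SuffixTranslate l l') (hc : Canonical l)
    (hc' : Canonical l') : l = l' := by
  induction l generalizing l' with
  | nil =>
    cases l' with
    | nil => rfl
    | cons => exact h.elim
  | cons a l ih =>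
    cases l' with
    | nil => exact h.elim
    | cons b l' =>
      rw [List.nodup_cons] at hl hl'
      have e1 : l.toFinset = (a :: l).toFinset.erase a := by
        rw [List.toFinset_cons, erase_insert (by simpa using hl.1)]
      have e2 : l'.toFinset = (a :: l).toFinset.erase b := by
        rw [hs, List.toFinset_cons, erase_insert (by simpa using hl'.1)]
      have ha : a ∈ (a :: l).toFinset := by simp
      have hb : b ∈ (a :: l).toFinset := by rw [hs]; simp
      have hlen := ((suffixTranslate_iff _ _).1 h.2).1
      rcases eq_or_ne l [] with rfl | hne
      · obtain rfl : l' = [] := List.length_eq_zero_iff.1 (by simpa using hlen.symm)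
        simpa using hs
      have hcard : 2 ≤ #(a :: l).toFinset := by
        rw [List.toFinset_card_of_nodup (List.nodup_cons.2 hl), List.length_cons]
        have := List.length_pos_iff.2 hne
        omega
      have htr : Translate l.toFinset l'.toFinset := by
        have hpos := List.length_pos_iff.2 hne
        simpa using ((suffixTranslate_iff _ _).1 h.2).2 0 hpos
      -- A positive shift would make `X` a progression with `a` its maximum, which canonicity
      -- forbids. It is stated generally because a negative shift is the same situation with the two
      -- words exchanged.
      have hno : ∀ {a b : ℤ} {l l' : List ℤ} {X : Finset ℤ} {t : ℤ}, a ∈ X → b ∈ X → 2 ≤ #X →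
          (a :: l).toFinset = X → l.toFinset = X.erase a → l'.toFinset = X.erase b →
          Canonical (a :: l) → 0 < t → l'.toFinset ≠ l.toFinset.image (· + t) := by
        intro a b l l' X t ha hb hX hal e1 e2 hc ht he
        obtain ⟨hap, hmax⟩ := isAP_of_erase_eq_image_erase ha hb hX ht (by rw [← e2, he, e1])
        obtain ⟨x, hx, hlt⟩ := hc.1 (hal ▸ hap)
        have := hmax x (by rw [← hal]; simp [hx])
        omega
      have heq : l.toFinset = l'.toFinset := by
        obtain ⟨t, ht⟩ := id htr
        rcases lt_trichotomy t 0 with h0 | rfl | h0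
        · refine absurd ?_ (hno (t := -t) hb ha hcard hs.symm e2 e1 hc' (by omega))
          rw [ht, image_image]
          simp only [Function.comp_def, add_neg_cancel_right, image_id']
        · simpa using ht.symm
        · exact absurd ht (hno ha hb hcard rfl e1 e2 hc h0)
      have hab : a = b := by
        by_contra hab
        have : a ∈ l'.toFinset := by rw [e2]; exact mem_erase.2 ⟨hab, ha⟩
        rw [← heq, e1] at this
        simp at this
      rw [hab, ih hl.2 hl'.2 heq h.2 hc.2 hc'.2]

/-- The word is built greedily, `X` being the set of letters still to be placed. The translated
letter `a + t` is used unless it is the maximum of a progression, in which case the minimum takes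
its place. -/
theorem exists_canonical_suffixTranslate {l : List ℤ} (hl : l.Nodup) {X : Finset ℤ}
    (hX : Translate l.toFinset X) :
    ∃ l' : List ℤ, l'.Nodup ∧ l'.toFinset = X ∧ SuffixTranslate l l' ∧ Canonical l' := by
  induction l generalizing X with
  | nil =>
    obtain ⟨t, rfl⟩ := hX
    exact ⟨[], List.nodup_nil, by simp, trivial, trivial⟩
  | cons a l ih =>
    rw [List.nodup_cons] at hl
    have hstep : ∀ b ∈ X, Translate l.toFinset (X.erase b) → (IsAP X → ∃ x ∈ X, b < x) →
        ∃ l' : List ℤ, l'.Nodup ∧ l'.toFinset = X ∧ SuffixTranslate (a :: l) l' ∧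
          Canonical l' := by
      intro b hb htr hbX
      obtain ⟨l', h1, h2, h3, h4⟩ := ih hl.2 htr
      have hset : (b :: l').toFinset = X := by
        rw [List.toFinset_cons, h2, insert_erase hb]
      refine ⟨b :: l', ?_, hset, ⟨by rwa [hset], h3⟩, ?_, h4⟩
      · rw [List.nodup_cons, ← List.mem_toFinset, h2]
        exact ⟨notMem_erase b X, h1⟩
      · rw [hset]
        intro hap
        obtain ⟨x, hx, hlt⟩ := hbX hap
        refine ⟨x, ?_, hlt⟩
        rw [← List.mem_toFinset, h2]
        exact mem_erase.2 ⟨hlt.ne', hx⟩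
    obtain ⟨t, ht⟩ := id hX
    have hat : a + t ∈ X := by rw [ht]; exact mem_image_of_mem (· + t) (by simp)
    have htr : Translate l.toFinset (X.erase (a + t)) := by
      refine ⟨t, ?_⟩
      rw [ht, List.toFinset_cons, image_insert, erase_insert]
      simpa using hl.1
    by_cases hcase : IsAP X ∧ ∀ x ∈ X, x ≤ a + t
    · obtain ⟨⟨m, d, c, hc, hd, hXeq⟩, hmax⟩ := hcase
      refine hstep m ?_ ?_ fun _ => ⟨m + (1 : ℕ) * d, ?_, by simpa using hd⟩
      · rw [hXeq]; exact mem_image.2 ⟨0, mem_range.2 (by omega), by simp⟩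
      · refine htr.trans ?_
        rw [hXeq] at hat hmax ⊢
        exact translate_erase_max_erase_min hc hd hat hmax
      · rw [hXeq]; exact mem_image.2 ⟨1, mem_range.2 (by omega), rfl⟩
    · refine hstep _ hat htr fun hap => ?_
      by_contra! hcon
      exact hcase ⟨hap, hcon⟩

end SSWilf

/-! ### Inverse words of permutations -/

namespace SSWilf
open Finset

variable {n : ℕ}

/-- The letters of a word as integers. -/
def intList (w : Word) : List ℤ := w.map (fun a : ℕ+ => ((a : ℕ) : ℤ))

theorem intList_injective : Function.Injective intList :=
  List.map_injective_iff.2 fun a b h => PNat.coe_injective (by exact_mod_cast h)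

theorem intList_drop (w : Word) (i : ℕ) : intList (w.drop i) = (intList w).drop i := by
  simp [intList]

theorem length_intList (w : Word) : (intList w).length = w.length := by simp [intList]

theorem intList_toFinset (w : Word) :
    (intList w).toFinset = (alph w).image ((↑) : ℕ → ℤ) := by
  ext x
  simp [alph_eq, intList]

theorem intList_word (σ : Equiv.Perm (Fin n)) :
    intList (word σ) = List.ofFn (fun k => ((σ k : ℕ) : ℤ) + 1) := by
  simp [intList, word, List.map_ofFn, Function.comp_def]

theorem length_word (σ : Equiv.Perm (Fin n)) : (word σ).length = n := by simp [word]

theorem word_injective : Function.Injective (word : Equiv.Perm (Fin n) → Word) := by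
  intro σ τ h
  ext k
  have := congrFun (List.ofFn_injective h) k
  have := congrArg PNat.natPred this
  simpa using this

theorem nodup_intList_word (σ : Equiv.Perm (Fin n)) : (intList (word σ)).Nodup := by
  rw [intList_word, List.nodup_ofFn]
  intro a b h
  simpa [Fin.val_inj] using h

theorem mem_word {σ : Equiv.Perm (Fin n)} {a : ℕ+} : a ∈ word σ ↔ (a : ℕ) ≤ n := by
  simp only [word, List.mem_ofFn]
  constructor
  · rintro ⟨k, rfl⟩
    have := (σ k).2
    simp
  · intro h
    have h1 := PNat.natPred_add_one a
    refine ⟨σ.symm ⟨a.natPred, by omega⟩, ?_⟩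
    simp

theorem toFinset_intList_word (σ : Equiv.Perm (Fin n)) :
    (intList (word σ)).toFinset = Icc 1 (n : ℤ) := by
  ext x
  simp only [intList, List.mem_toFinset, List.mem_map, mem_word, mem_Icc]
  constructor
  · rintro ⟨a, ha, rfl⟩
    have := a.pos
    omega
  · rintro ⟨h1, h2⟩
    exact ⟨⟨x.toNat, by omega⟩, by simp only [PNat.mk_coe]; omega,
      by simp only [PNat.mk_coe]; omega⟩

theorem exists_perm_intList_eq {l : List ℤ} (hl : l.Nodup) (hs : l.toFinset = Icc 1 (n : ℤ)) :
    ∃ σ : Equiv.Perm (Fin n), intList (word σ) = l := by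
  have hlen : l.length = n := by
    rw [← List.toFinset_card_of_nodup hl, hs]; simp
  subst hlen
  have hmem : ∀ k : Fin l.length, 1 ≤ l[k] ∧ l[k] ≤ l.length := fun k => by
    rw [← mem_Icc, ← hs, List.mem_toFinset]
    exact List.getElem_mem _
  let f : Fin l.length → Fin l.length := fun k =>
    ⟨(l[k] - 1).toNat, by have := hmem k; omega⟩
  have hf : Function.Injective f := by
    intro a b h
    have h1 := hmem a
    have h2 := hmem b
    have h3 : (l[a] - 1).toNat = (l[b] - 1).toNat := congrArg Fin.val h
    have h4 : l[a] = l[b] := by omega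
    exact Fin.ext ((List.Nodup.getElem_inj_iff hl).1 h4)
  refine ⟨Equiv.ofBijective f (Finite.injective_iff_bijective.1 hf), ?_⟩
  rw [intList_word]
  apply List.ext_getElem (by simp)
  intro k h1 h2
  have := hmem ⟨k, h2⟩
  simp only [Fin.getElem_fin] at this
  simp only [List.getElem_ofFn, Equiv.ofBijective_apply, f, Fin.getElem_fin]
  omega

/-- The positions where σ is at least `i` are the values of `σ⁻¹` at the indices from `i` on; the
shift by 1 is due to letters starting at 1. -/
theorem image_level_eq_drop_inv (σ : Equiv.Perm (Fin n)) (i : ℕ) :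
    (level σ i).image (· + 1) = ((intList (word σ⁻¹)).drop i).toFinset := by
  ext x
  rw [intList_word]
  simp only [level, mem_image, mem_filter, mem_univ, true_and, exists_exists_and_eq_and,
    List.mem_toFinset, List.mem_drop_iff_getElem, List.getElem_ofFn, List.length_ofFn]
  constructor
  · rintro ⟨k, hk, rfl⟩
    exact ⟨σ k - i, by have := (σ k).2; omega, by simp [Nat.add_sub_cancel' hk]⟩
  · rintro ⟨j, hj, rfl⟩
    exact ⟨σ⁻¹ ⟨i + j, by omega⟩, by simp, rfl⟩

theorem equivalent_word_iff_suffixTranslate (σ τ : Equiv.Perm (Fin n)) :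
    Equivalent (word σ) (word τ) ↔
      SuffixTranslate (intList (word σ⁻¹)) (intList (word τ⁻¹)) := by
  rw [equivalent_word_iff, suffixTranslate_iff]
  simp only [length_intList, length_word, true_and]
  refine forall₂_congr fun i _ => ?_
  rw [← image_level_eq_drop_inv, ← image_level_eq_drop_inv]
  have h : ∀ X : Finset ℤ, Translate X (X.image (· + 1)) := fun X => ⟨1, rfl⟩
  exact ⟨fun H => ((h _).symm.trans H).trans (h _), fun H => ((h _).trans H).trans (h _).symm⟩

theorem existsUnique_canonical (σ : Equiv.Perm (Fin n)) :
    ∃! τ : Equiv.Perm (Fin n), Canonical (intList (word τ⁻¹)) ∧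
      Equivalent (word σ) (word τ) := by
  obtain ⟨l, h1, h2, h3, h4⟩ := exists_canonical_suffixTranslate (nodup_intList_word σ⁻¹)
    (Translate.refl _)
  rw [toFinset_intList_word] at h2
  obtain ⟨τ, rfl⟩ := exists_perm_intList_eq h1 h2
  refine ⟨τ⁻¹, ⟨by rwa [inv_inv], ?_⟩, ?_⟩
  · rwa [equivalent_word_iff_suffixTranslate, inv_inv]
  · rintro ρ ⟨hc, he⟩
    have he' := equivalent_equivalence.trans (equivalent_equivalence.symm he)
      ((equivalent_word_iff_suffixTranslate σ τ⁻¹).2 (by rwa [inv_inv]))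
    rw [equivalent_word_iff_suffixTranslate, inv_inv] at he'
    have := eq_of_suffixTranslate_of_canonical (nodup_intList_word _) h1
      (by rw [h2, toFinset_intList_word]) he' hc h4
    rw [eq_comm, inv_eq_iff_eq_inv]
    exact word_injective (intList_injective this.symm)

/-! ### Periodic sets are arithmetic progressions -/

theorem differences_image_range (m : ℕ) {d : ℕ} (hd : 0 < d) (c : ℕ) :
    differences ((range c).image (fun k => m + k * d)) = List.replicate (c - 1) d := by
  have hmono : StrictMono (fun k : ℕ => m + k * d) := fun a b h => by
    have := Nat.mul_lt_mul_of_pos_right h hd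
    simpa using this
  have hsort : ((range c).image (fun k => m + k * d)).sort (· ≤ ·) =
      (List.range c).map (fun k => m + k * d) := by
    have hn : ((List.range c).map (fun k => m + k * d)).Nodup :=
      (List.nodup_range).map hmono.injective
    have he : (range c).image (fun k => m + k * d) =
        ((List.range c).map (fun k => m + k * d)).toFinset := by
      ext x; simp
    rw [he, List.toFinset_sort (· ≤ ·) hn, List.pairwise_map]
    exact List.pairwise_lt_range.imp fun h => (hmono h).le
  rw [differences, hsort]
  apply List.ext_getElem
  · simp
  · intro k h1 h2
    simp [Nat.add_mul]
    omega

theorem periodic_iff_isAP (X : Finset ℕ) : Periodic X ↔ IsAP (X.image ((↑) : ℕ → ℤ)) := by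
  constructor
  · rintro ⟨h2, d, hd, h⟩
    set L := X.sort (· ≤ ·) with hL
    have hlen : L.length = #X := by simp [L]
    have hpos : 0 < L.length := by omega
    have hsorted : L.Pairwise (· ≤ ·) := X.pairwise_sort (· ≤ ·)
    have hstep : ∀ k (hk : k + 1 < L.length), L[k + 1] = L[k] + d := by
      intro k hk
      have hle : L[k] ≤ L[k + 1] := List.pairwise_iff_getElem.1 hsorted k (k + 1) _ _ (by omega)
      have hk' : k < (differences X).length := by rw [h, List.length_replicate]; omega
      have e : (differences X)[k] = L[k + 1] - L[k] := by simp [differences, L]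
      have e' : (differences X)[k] = d := by simp [h]
      omega
    have hform : ∀ k (hk : k < L.length), L[k] = L[0] + k * d := by
      intro k
      induction k with
      | zero => simp
      | succ k ih =>
        intro hk
        rw [hstep k hk, ih (by omega)]
        ring
    refine ⟨L[0], d, #X, h2, by exact_mod_cast hd, ?_⟩
    ext x
    simp only [mem_image, mem_range]
    constructor
    · rintro ⟨y, hy, rfl⟩
      obtain ⟨k, hk, rfl⟩ := List.getElem_of_mem ((X.mem_sort (· ≤ ·)).2 hy)
      refine ⟨k, by simpa using hk, ?_⟩
      have := hform k hk
      exact_mod_cast this.symm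
    · rintro ⟨k, hk, rfl⟩
      refine ⟨L[k], (X.mem_sort (· ≤ ·)).1 (List.getElem_mem _), ?_⟩
      rw [hform k (by omega)]
      push_cast
      rfl
  · rintro ⟨m, d, c, hc, hd, h⟩
    have hm : m + (0 : ℕ) * d ∈ X.image ((↑) : ℕ → ℤ) := by
      rw [h]; exact mem_image_of_mem (fun k : ℕ => m + k * d) (mem_range.2 (by omega))
    obtain ⟨m, -, e⟩ := mem_image.1 hm
    simp only [Nat.cast_zero, zero_mul, add_zero] at e
    subst e
    lift d to ℕ using hd.le
    have hX : X = (range c).image (fun k => m + k * d) := by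
      apply image_injective (Nat.cast_injective (R := ℤ))
      rw [h, image_image]
      exact image_congr fun k _ => by simp
    have hd' : 0 < d := by exact_mod_cast hd
    have hcard : #X = c := by
      rw [hX, card_image_of_injective, card_range]
      intro a b hab
      exact Nat.eq_of_mul_eq_mul_right hd' (Nat.add_left_cancel hab)
    refine ⟨by omega, d, hd', ?_⟩
    rw [hcard, hX]
    exact differences_image_range m hd' c

theorem periodic_alph_iff (w : Word) : Periodic (alph w) ↔ IsAP (intList w).toFinset := by
  rw [periodic_iff_isAP, intList_toFinset]

end SSWilf

/-! ### The recursion for `R` describes the canonical words -/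

namespace SSWilf
open Finset

variable {n : ℕ}

/-- The letter `m + k * d` has `k` smaller ones, so it reduces to `k + 1`, and `m + k * d = (m - d)
+ (k + 1) * d`. -/
theorem intList_eq_map_red {v : Word} {m d : ℤ} {c : ℕ} (hd : 0 < d)
    (h : (intList v).toFinset = (range c).image (fun k : ℕ => m + k * d)) :
    intList v = (intList (red v)).map (fun x => (m - d) + x * d) := by
  have hinj := injective_progression m hd
  rw [intList, red, intList, List.map_map, List.map_map]
  refine List.map_congr_left fun a ha => ?_
  have hmem : ∀ b ∈ v, ∃ k < c, m + (k : ℤ) * d = ((b : ℕ) : ℤ) := by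
    intro b hb
    have : ((b : ℕ) : ℤ) ∈ (intList v).toFinset := by
      rw [List.mem_toFinset]; exact List.mem_map_of_mem hb
    rw [h] at this
    simpa using this
  obtain ⟨k, hk, e⟩ := hmem a ha
  have hcard : #(v.toFinset.filter (fun b => b < a)) = k := by
    have hf : (fun b : ℕ+ => ((b : ℕ) : ℤ)).Injective := fun x y hxy =>
      PNat.coe_injective (Nat.cast_injective hxy)
    rw [← card_image_of_injective _ hf, ← card_range k, ← card_image_of_injective (range k) hinj]
    congr 1
    ext x
    simp only [mem_image, mem_filter, List.mem_toFinset, mem_range]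
    constructor
    · rintro ⟨b, ⟨hb, hlt⟩, rfl⟩
      obtain ⟨j, -, e'⟩ := hmem b hb
      refine ⟨j, ?_, e'⟩
      have hlt' : ((b : ℕ) : ℤ) < ((a : ℕ) : ℤ) := by exact_mod_cast hlt
      rw [← e, ← e'] at hlt'
      have := lt_of_mul_lt_mul_right (lt_of_add_lt_add_left hlt') hd.le
      exact_mod_cast this
    · rintro ⟨j, hj, rfl⟩
      have hj' : m + (j : ℤ) * d ∈ (intList v).toFinset := by
        rw [h]; exact mem_image_of_mem (fun k : ℕ => m + k * d) (mem_range.2 (hj.trans hk))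
      rw [List.mem_toFinset, intList, List.mem_map] at hj'
      obtain ⟨b, hb, e'⟩ := hj'
      refine ⟨b, ⟨hb, ?_⟩, e'⟩
      have hlt : ((b : ℕ) : ℤ) < ((a : ℕ) : ℤ) := by
        rw [← e, e']
        have : (j : ℤ) * d < k * d := mul_lt_mul_of_pos_right (by exact_mod_cast hj) hd
        omega
      exact_mod_cast hlt
  simp only [Function.comp_apply, hcard, Nat.succPNat_coe, Nat.succ_eq_add_one]
  rw [← e]
  push_cast
  ring

theorem canonical_red_iff {v : Word} (h : IsAP (intList v).toFinset) :
    Canonical (intList (red v)) ↔ Canonical (intList v) := by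
  obtain ⟨m, d, c, -, hd, h⟩ := h
  conv_rhs => rw [intList_eq_map_red hd h]
  rw [canonical_map_iff _ hd]

theorem exists_perm_word_eq_red {v : Word} (hv : (intList v).Nodup)
    (h : IsAP (intList v).toFinset) : ∃ τ : Equiv.Perm (Fin v.length), red v = word τ := by
  obtain ⟨m, d, c, -, hd, h⟩ := h
  have hmap := intList_eq_map_red hd h
  have hc : c = v.length := by
    rw [← length_intList, ← List.toFinset_card_of_nodup hv, h,
      card_image_of_injective _ (injective_progression m hd), card_range]
  obtain ⟨τ, hτ⟩ := exists_perm_intList_eq (n := v.length) (l := intList (red v))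
    (by rw [hmap] at hv; exact hv.of_map _) (by
      have hinj : Function.Injective (fun x : ℤ => (m - d) + x * d) := fun a b h =>
        mul_right_cancel₀ hd.ne' (add_left_cancel h)
      apply image_injective hinj
      have : (intList (red v)).toFinset.image (fun x => (m - d) + x * d) =
          (intList v).toFinset := by
        conv_rhs => rw [hmap]
        ext x
        simp
      rw [this, h, ← hc]
      ext x
      simp only [mem_image, mem_range, mem_Icc]
      constructor
      · rintro ⟨k, hk, rfl⟩
        exact ⟨k + 1, by omega, by ring⟩
      · rintro ⟨y, hy, rfl⟩
        refine ⟨(y - 1).toNat, by omega, ?_⟩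
        rw [Int.toNat_of_nonneg (by omega)]
        ring)
  exact ⟨τ, (intList_injective hτ).symm⟩

theorem sdiff_alph_take (σ : Equiv.Perm (Fin n)) (j : ℕ) :
    Icc 1 n \ alph ((word σ).take j) = alph ((word σ).drop j) := by
  apply image_injective (Nat.cast_injective (R := ℤ))
  rw [image_sdiff _ _ Nat.cast_injective, ← intList_toFinset, ← intList_toFinset]
  have h1 : (Icc 1 n).image ((↑) : ℕ → ℤ) = (intList (word σ)).toFinset := by
    rw [toFinset_intList_word]
    ext x
    simp only [mem_image, mem_Icc]
    exact ⟨fun ⟨a, ha, e⟩ => by omega, fun h => ⟨x.toNat, by omega, by omega⟩⟩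
  have hnd := nodup_intList_word σ
  have hsplit : intList (word σ) =
      intList ((word σ).take j) ++ intList ((word σ).drop j) := by
    rw [intList, intList, intList, ← List.map_append, List.take_append_drop]
  rw [h1]
  rw [hsplit] at hnd ⊢
  rw [List.nodup_append] at hnd
  ext x
  simp only [mem_sdiff, List.mem_toFinset, List.mem_append]
  have := hnd.2.2
  constructor
  · tauto
  · exact fun hx => ⟨Or.inr hx, fun hx' => this x hx' x hx rfl⟩

theorem take_mem_D_iff (σ : Equiv.Perm (Fin n)) {i : ℕ} (hi : i ≤ n) :
    (word σ).take i ∈ D i n ↔ IsAP (intList ((word σ).drop i)).toFinset ∧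
      ∀ j, 1 ≤ j → j < i → ¬ IsAP (intList ((word σ).drop j)).toFinset := by
  simp only [D, Set.mem_ofPred_eq, List.length_take, length_word, sdiff_alph_take,
    periodic_alph_iff]
  constructor
  · rintro ⟨-, -, h, H⟩
    refine ⟨h, fun j h1 h2 => ?_⟩
    have := H j h1 h2
    rwa [List.take_take, min_eq_left h2.le, sdiff_alph_take, periodic_alph_iff] at this
  · rintro ⟨h, H⟩
    refine ⟨min_eq_left hi, ⟨σ, List.take_prefix _ _⟩, h, fun j h1 h2 => ?_⟩
    rw [List.take_take, min_eq_left h2.le, sdiff_alph_take, periodic_alph_iff]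
    exact H j h1 h2

/-- After removing an interior point, two consecutive integers remain, which forces `d = 1` and
contradicts the gap at `a`. For `N = 3` this fails: `{1, 3}` is a progression. -/
theorem eq_one_or_eq_of_isAP_erase {N a : ℤ} (hN : 4 ≤ N) (h1 : 1 ≤ a) (ha : a ≤ N)
    (h : IsAP ((Icc 1 N).erase a)) : a = 1 ∨ a = N := by
  obtain ⟨m, d, c, -, hd, h⟩ := h
  by_contra! hcon
  have hmem : ∀ x, x ≠ a → 1 ≤ x → x ≤ N → ∃ k < c, m + (k : ℤ) * d = x := by
    intro x hx hx1 hxN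
    have : x ∈ (Icc 1 N).erase a := mem_erase.2 ⟨hx, mem_Icc.2 ⟨hx1, hxN⟩⟩
    rw [h] at this
    simpa using this
  have hone : d = 1 := by
    have key : ∀ x, x ≠ a → x + 1 ≠ a → 1 ≤ x → x + 1 ≤ N → d = 1 := by
      intro x h1 h2 h3 h4
      obtain ⟨k, -, e⟩ := hmem x h1 h3 (by omega)
      obtain ⟨l, -, e'⟩ := hmem (x + 1) h2 (by omega) h4
      have hdvd : d ∣ 1 := ⟨l - k, by linear_combination e - e'⟩
      exact le_antisymm (Int.le_of_dvd one_pos hdvd) (by omega)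
    by_cases h3 : a = 2
    · exact key 3 (by omega) (by omega) (by omega) (by omega)
    · exact key 1 (by omega) (by omega) (by omega) (by omega)
  subst hone
  obtain ⟨k, hk, e⟩ := hmem (a - 1) (by omega) (by omega) (by omega)
  obtain ⟨l, hl, e'⟩ := hmem (a + 1) (by omega) (by omega) (by omega)
  have : a ∈ (Icc 1 N).erase a := by
    rw [h]
    exact mem_image.2 ⟨k + 1, mem_range.2 (by omega), by push_cast; omega⟩
  simp at this

/-- The first letter of `w` is not the largest, and the suffix after `i` letters is the first proper
suffix of `w` whose letters form a progression. -/
def FirstPeriodic (w : Word) (i : ℕ) : Prop :=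
  IsAP (intList (w.drop i)).toFinset ∧
    (∀ j, 1 ≤ j → j < i → ¬ IsAP (intList (w.drop j)).toFinset) ∧
    ∃ b ∈ intList (w.drop 1), ∀ h : 0 < (intList w).length, (intList w)[0] < b

theorem intList_drop_one_toFinset (σ : Equiv.Perm (Fin n)) (h : 0 < (intList (word σ)).length) :
    (intList ((word σ).drop 1)).toFinset = (Icc 1 (n : ℤ)).erase (intList (word σ))[0] := by
  have hnd := nodup_intList_word σ
  have hs := toFinset_intList_word σ
  rw [intList_drop]
  generalize intList (word σ) = l at *
  cases l with
  | nil => simp at h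
  | cons a l =>
    rw [← hs, List.toFinset_cons]
    simp only [List.drop_succ_cons, List.drop_zero, List.getElem_cons_zero]
    rw [erase_insert]
    simpa using (List.nodup_cons.1 hnd).1

theorem take_one_eq_iff {w : Word} (h : 0 < (intList w).length) :
    w.take 1 = [1] ↔ (intList w)[0] = 1 := by
  cases w with
  | nil => simp [intList] at h
  | cons a w => simp [intList]

/-- The suffix after one letter is periodic exactly when that letter is 1 or `n`. For `i = 1`, not
being the largest leaves only 1, which is why `E` has its special case; for `i ≥ 2`, non-periodicity
at `j = 1` already excludes `n`. -/
theorem take_mem_E_iff (σ : Equiv.Perm (Fin n)) (hn : 4 ≤ n) {i : ℕ} (h1 : 1 ≤ i) (hi : i ≤ n) :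
    (word σ).take i ∈ E i n ↔ FirstPeriodic (word σ) i := by
  have hlen : 0 < (intList (word σ)).length := by rw [length_intList, length_word]; omega
  have hdrop := intList_drop_one_toFinset σ hlen
  have hbound : (intList (word σ))[0] ∈ Icc 1 (n : ℤ) := by
    rw [← toFinset_intList_word σ, List.mem_toFinset]; exact List.getElem_mem _
  rw [mem_Icc] at hbound
  have hlast : (∃ b ∈ intList ((word σ).drop 1), ∀ h : 0 < (intList (word σ)).length,
      (intList (word σ))[0] < b) ↔ (intList (word σ))[0] ≠ n := by
    simp only [← List.mem_toFinset (l := intList _), hdrop, mem_erase, mem_Icc]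
    constructor
    · rintro ⟨b, ⟨-, -, hb⟩, hlt⟩
      have := hlt hlen
      omega
    · intro hne
      exact ⟨n, ⟨hne.symm, by omega, le_rfl⟩, fun _ => by omega⟩
  have hone : IsAP (intList ((word σ).drop 1)).toFinset ↔
      (intList (word σ))[0] = 1 ∨ (intList (word σ))[0] = n := by
    rw [hdrop]
    constructor
    · exact eq_one_or_eq_of_isAP_erase (by omega) hbound.1 hbound.2
    · rintro (h | h) <;> rw [h]
      · convert isAP_Icc (a := 2) (b := n) (by omega) using 1
        ext x; simp only [mem_erase, mem_Icc]; omega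
      · convert isAP_Icc (a := 1) (b := n - 1) (by omega) using 1
        ext x; simp only [mem_erase, mem_Icc]; omega
  rw [FirstPeriodic, hlast]
  rcases eq_or_ne i 1 with rfl | hi1
  · rw [hone, E, if_pos rfl, Set.mem_singleton_iff]
    have hE : (word σ).take 1 = [1] ↔ (intList (word σ))[0] = 1 := take_one_eq_iff hlen
    rw [hE]
    constructor
    · intro h
      exact ⟨Or.inl h, fun j _ _ => by omega, by omega⟩
    · rintro ⟨h | h, -, h'⟩
      · exact h
      · exact absurd h h'
  · rw [E, if_neg hi1, take_mem_D_iff σ hi]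
    constructor
    · rintro ⟨h, H⟩
      exact ⟨h, H, fun hc => H 1 le_rfl (by omega) (hone.2 (Or.inr hc))⟩
    · rintro ⟨h, H, -⟩
      exact ⟨h, H⟩

/-- Canonicity constrains only periodic suffixes: the whole word, whose letter set is an interval,
and then nothing before the first proper periodic suffix. -/
theorem canonical_word_iff (σ : Equiv.Perm (Fin n)) (hn : 4 ≤ n) :
    Canonical (intList (word σ)) ↔ ∃ i, (1 ≤ i ∧ i ≤ n - 2) ∧ FirstPeriodic (word σ) i ∧
      Canonical (intList ((word σ).drop i)) := by
  have hlen : (intList (word σ)).length = n := by rw [length_intList, length_word]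
  have htop : IsAP (intList (word σ)).toFinset := by
    rw [toFinset_intList_word]; exact isAP_Icc (by omega)
  simp only [FirstPeriodic, canonical_iff, intList_drop]
  constructor
  · intro H
    classical
    have hex : ∃ i, 1 ≤ i ∧ IsAP ((intList (word σ)).drop i).toFinset := by
      -- Two distinct letters always form a progression, so a cut exists.
      refine ⟨n - 2, by omega, ?_⟩
      have h2 : ((intList (word σ)).drop (n - 2)).length = 2 := by
        rw [List.length_drop, hlen]; omega
      have hnd := (nodup_intList_word σ).sublist (List.drop_sublist (n - 2) _)
      obtain ⟨a, b, e⟩ := List.length_eq_two.1 h2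
      rw [e] at hnd ⊢
      have hab : a ≠ b := by simpa using hnd
      rcases lt_or_gt_of_ne hab with h | h
      · simpa using isAP_pair h
      · simpa [Finset.pair_comm] using isAP_pair h
    have hspec := Nat.find_spec hex
    refine ⟨Nat.find hex, ⟨hspec.1, ?_⟩, ⟨hspec.2, ?_, ?_⟩, ?_⟩
    · have := hspec.2.two_le_card.trans (List.toFinset_card_le _)
      rw [List.length_drop, hlen] at this
      omega
    · exact fun j hj hlt hap => Nat.find_min hex hlt ⟨hj, hap⟩
    · obtain ⟨b, hb, hlt⟩ := H 0 (by omega) (by simpa using htop)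
      exact ⟨b, by simpa using hb, fun _ => hlt⟩
    · intro k hk hap
      rw [List.length_drop] at hk
      have := H (Nat.find hex + k) (by omega) (by rwa [List.drop_drop] at hap)
      simpa [List.drop_drop, add_assoc] using this
  · rintro ⟨i, ⟨h1, h2⟩, ⟨-, hmin, b, hb, hlt⟩, H⟩ k hk hap
    rcases Nat.eq_zero_or_pos k with rfl | hk0
    · exact ⟨b, by simpa using hb, hlt (by omega)⟩
    rcases lt_or_ge k i with hki | hki
    · exact absurd hap (hmin k hk0 hki)
    · obtain ⟨j, rfl⟩ := Nat.exists_eq_add_of_le hki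
      have := H j (by rw [List.length_drop]; omega) (by rwa [List.drop_drop])
      simpa [List.drop_drop, add_assoc] using this

theorem canonical_triple {a b c : ℤ} (h : IsAP {a, b, c}) (hbc : b ≠ c) :
    Canonical [a, b, c] ↔ (a < b ∨ a < c) ∧ b < c := by
  have h1 : ¬ IsAP {c} := fun h => by simpa using h.two_le_card
  have h2 : IsAP {b, c} := by
    rcases lt_or_gt_of_ne hbc with h | h
    · exact isAP_pair h
    · rw [Finset.pair_comm]; exact isAP_pair h
  simp [Canonical, h, h1, h2]

/-- Words in `E i (n + 4)` have length `i`, so the factorization is determined by `i`. -/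
theorem mem_R_add_four {n : ℕ} (w : Equiv.Perm (Fin (n + 4))) :
    w ∈ R (n + 4) ↔ ∃ i, (1 ≤ i ∧ i ≤ n + 4 - 2) ∧ (word w).take i ∈ E i (n + 4) ∧
      ∃ τ ∈ R (n + 4 - i), red ((word w).drop i) = word τ := by
  rw [R, Set.mem_ofPred_eq]
  constructor
  · rintro ⟨i, hi, u, v, hw, hu, τ, hτ, hv⟩
    have hlen : u.length = i := by
      rw [E] at hu
      split_ifs at hu with h
      · rw [Set.mem_singleton_iff] at hu
        simp [hu, h]
      · exact hu.1
    refine ⟨i, hi, ?_, τ, hτ, ?_⟩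
    · rwa [hw, List.take_left' hlen]
    · rwa [hw, List.drop_left' hlen]
  · rintro ⟨i, hi, hu, τ, hτ, hv⟩
    exact ⟨i, hi, _, _, (List.take_append_drop i _).symm, hu, τ, hτ, hv⟩

theorem mem_R_iff_canonical (hn : 1 ≤ n) (w : Equiv.Perm (Fin n)) :
    w ∈ R n ↔ Canonical (intList (word w)) := by
  induction n using Nat.strong_induction_on with
  | _ n ih =>
    match n, hn with
    | 1, _ =>
      have h1 : ∀ a : ℤ, ¬ IsAP {a} := fun a h => by simpa using h.two_le_card
      simp [R, intList_word, Canonical, h1, Subsingleton.elim w 1]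
    | 2, _ =>
      have key : w ∈ R 2 ↔ w 0 < w 1 := by
        rw [R, Set.mem_singleton_iff]
        revert w
        decide
      have h1 : ∀ a : ℤ, ¬ IsAP {a} := fun a h => by simpa using h.two_le_card
      have h2 : IsAP {((w 0 : ℕ) : ℤ) + 1, ((w 1 : ℕ) : ℤ) + 1} := by
        have h := toFinset_intList_word w
        rw [intList_word] at h
        simp only [List.ofFn_succ, List.ofFn_zero, List.toFinset_cons, List.toFinset_nil] at h
        have h' := isAP_Icc (a := 1) (b := (2 : ℕ)) (by norm_num)
        rw [← h] at h'
        exact h'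
      rw [key, intList_word]
      simp only [List.ofFn_succ, List.ofFn_zero, Fin.succ_zero_eq_one]
      simp [Canonical, h1, h2]
    | 3, _ =>
      have key : w ∈ R 3 ↔ (w 0 < w 1 ∨ w 0 < w 2) ∧ w 1 < w 2 := by
        rw [R, Set.mem_insert_iff, Set.mem_singleton_iff]
        revert w
        decide
      have h3 : IsAP {((w 0 : ℕ) : ℤ) + 1, ((w 1 : ℕ) : ℤ) + 1, ((w 2 : ℕ) : ℤ) + 1} := by
        have h := toFinset_intList_word w
        rw [intList_word] at h
        simp only [List.ofFn_succ, List.ofFn_zero, List.toFinset_cons, List.toFinset_nil] at h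
        have h' := isAP_Icc (a := 1) (b := (3 : ℕ)) (by norm_num)
        rw [← h] at h'
        exact h'
      have hne : ((w 1 : ℕ) : ℤ) + 1 ≠ ((w 2 : ℕ) : ℤ) + 1 := by
        intro h
        have h' : w 1 = w 2 := Fin.ext (by omega)
        exact absurd (w.injective h') (by decide)
      have hcan := canonical_triple h3 hne
      have hw : intList (word w) =
          [((w 0 : ℕ) : ℤ) + 1, ((w 1 : ℕ) : ℤ) + 1, ((w 2 : ℕ) : ℤ) + 1] := by
        rw [intList_word]
        rfl
      rw [key, hw, hcan]
      simp only [add_lt_add_iff_right, Nat.cast_lt, Fin.val_fin_lt]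
    | n + 4, _ =>
      rw [mem_R_add_four, canonical_word_iff w (by omega)]
      refine exists_congr fun i => and_congr_right fun hi => ?_
      rw [take_mem_E_iff w (by omega) hi.1 (by omega)]
      refine and_congr_right fun hF => ?_
      rw [← canonical_red_iff hF.1]
      constructor
      · rintro ⟨τ, hτ, hv⟩
        rw [hv]
        exact (ih _ (by omega) (by omega) τ).1 hτ
      · intro hc
        have hnd : (intList ((word w).drop i)).Nodup := by
          rw [intList_drop]
          exact (nodup_intList_word w).sublist (List.drop_sublist _ _)
        have hlen : ((word w).drop i).length = n + 4 - i := by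
          rw [List.length_drop, length_word]
        have hex := exists_perm_word_eq_red hnd hF.1
        rw [hlen] at hex
        obtain ⟨τ, hτ⟩ := hex
        exact ⟨τ, (ih _ (by omega) (by omega) τ).2 (hτ ▸ hc), hτ⟩

theorem mem_C_iff_canonical (hn : 1 ≤ n) (c : Equiv.Perm (Fin n)) :
    c ∈ C n ↔ Canonical (intList (word c⁻¹)) := by
  rw [← mem_R_iff_canonical hn]
  exact ⟨fun ⟨w, hw, e⟩ => by rwa [e, inv_inv], fun h => ⟨c⁻¹, h, (inv_inv c).symm⟩⟩

end SSWilf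

theorem corollary3p7 (n : ℕ) (hn : 1 ≤ n) (u : Equiv.Perm (Fin n)) :
    ∃! c : Equiv.Perm (Fin n), c ∈ SSWilf.C n ∧
      SSWilf.Equivalent (SSWilf.word u) (SSWilf.word c) := by
  simpa only [SSWilf.mem_C_iff_canonical hn] using SSWilf.existsUnique_canonical u
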